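/- Conventions. All modules $M,N,X$ below are finitely generated. For a finitely generated module $M$ over a Noetherian local ring $S$, $\operatorname{depth}_S(M)$ is the supremum of the lengths of $M$-regular sequences in the maximal ideal, with $\operatorname{depth}(0)=\infty$. For an ideal $I$, $\operatorname{grade}(I)$ is the supremum of the lengths of $R$-regular sequences in $I$ (with $\operatorname{grade}(R)=\infty$). A module $M$ over a commutative Noetherian ring $R$ satisfies $(S_m)$ if $\operatorname{depth}_{R_{\mathfrak q}}(M_{\mathfrak q})\ge \min\{m,\dim R_{\mathfrak q}\}$ for every $\mathfrak q\in\operatorname{Supp}_R(M)$; the ring $R$ satisfies $(S_m)$ if it does so as a module over itself. A module is torsion if each of its elements is annihilated by a non-zero-divisor of $R$. An Auslander transpose $\operatorname{Tr}(X)$ of $X$ is the cokernel of $\operatorname{Hom}_R(P_0,R)\to\operatorname{Hom}_R(P_1,R)$, where $P_1\to P_0\to X\to 0$ is an exact sequence with $P_0,P_1$ finitely generated projective; it is determined by $X$ up to projective direct summands, and the statement holds for every choice. Theorem. Let $R$ be a commutative Noetherian ring (not necessarily local), let $n\ge 0$ be an integer, and let $\mathfrak p\in\operatorname{Spec}(R)$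 with $\operatorname{grade}(\mathfrak p)\ge 1$ and $\operatorname{height}(\mathfrak p)=n+1$. Let $X$ be a finitely generated $R$-module and let $N=\operatorname{Tr}(X)$. Assume: (i) $R$ satisfies $(S_{n+1})$; (ii) $X$ is torsion, $X_{\mathfrak p}$ is not a free $R_{\mathfrak p}$-module, and $X_{\mathfrak q}$ is a free $R_{\mathfrak q}$-module for each $\mathfrak q\in\operatorname{Spec}(R)$ with $\mathfrak q\not\supseteq\mathfrak p$; (iii) $M\neq 0$ is a finitely generated $R$-module that satisfies $(S_{n+2})$ and $\mathfrak p\notin\operatorname{Supp}_R(M)$. Then the following hold: (1) $M\otimes_R N$ satisfies $(S_{n+1})$. (2) $\operatorname{Tor}_i^R(M,N)=0$ for all $i\ge 1$, and $\operatorname{pd}_R(N)=1$. (3) $N$ satisfies $(S_n)$, but $N$ does not satisfy $(S_{n+1})$. -/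

import Mathlib

universe u v

open CategoryTheory

/-- The grade of an ideal `I` on a module `M`: the supremum of the lengths of the `M`-sequences
contained in `I`. Weakly regular sequences are used, so that the value is `⊤` whenever `M` is
finitely generated with `I • M = M` (in particular for `M = 0`). When `I • M ≠ M`, every weakly
regular sequence in `I` is regular, so weak and strong regularity give the same value. -/
noncomputable def moduleGrade {R : Type u} [CommRing R] (I : Ideal R)
    (M : Type v) [AddCommGroup M] [Module R M] : ℕ∞ :=
  ⨆ (rs : List R) (_ : (∀ r ∈ rs, r ∈ I) ∧ RingTheory.Sequence.IsWeaklyRegular M rs),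
    (rs.length : ℕ∞)

/-- The depth of a module over a local ring, with the convention `depth 0 = ⊤`. -/
noncomputable def moduleDepth (R : Type u) [CommRing R] [IsLocalRing R]
    (M : Type v) [AddCommGroup M] [Module R M] : ℕ∞ :=
  moduleGrade (IsLocalRing.maximalIdeal R) M

/-- Serre's condition `(S_n)` on a module: `depth M_q ≥ min {n, dim R_q}` for every `q` in the
support of `M`. -/
def SatisfiesSerre (R : Type u) [CommRing R] (M : Type v) [AddCommGroup M] [Module R M]
    (n : ℕ) : Prop :=
  ∀ q ∈ Module.support R M,
    min ((n : ℕ∞) : WithBot ℕ∞) (ringKrullDim (Localization.AtPrime q.asIdeal)) ≤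
      ((moduleDepth (Localization.AtPrime q.asIdeal)
        (LocalizedModule q.asIdeal.primeCompl M) : ℕ∞) : WithBot ℕ∞)

/-- `N` is an Auslander transpose of `X`: there is a presentation `P₁ → P₀ → X → 0` of `X` by
finitely generated projective modules such that `N` is isomorphic to the cokernel of the dual map
`Hom(P₀, R) → Hom(P₁, R)`. (The transpose is only defined up to projective summands, so this is a
relation between `X` and `N`.) -/
def IsAuslanderTranspose (R : Type u) [CommRing R] (X : Type u) [AddCommGroup X] [Module R X]
    (N : Type u) [AddCommGroup N] [Module R N] : Prop :=
  ∃ (P₁ P₀ : Type u) (_ : AddCommGroup P₁) (_ : AddCommGroup P₀)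
    (_ : Module R P₁) (_ : Module R P₀) (f : P₁ →ₗ[R] P₀) (g : P₀ →ₗ[R] X),
    Module.Finite R P₁ ∧ Module.Projective R P₁ ∧ Module.Finite R P₀ ∧ Module.Projective R P₀ ∧
    Function.Exact f g ∧ Function.Surjective g ∧
    Nonempty (N ≃ₗ[R] (Module.Dual R P₁ ⧸ LinearMap.range f.dualMap))

/-!
A presentation `f : P₁ → P₀` of `X` dualizes to `φ : P₀* → P₁*` with cokernel `N`. Everything
comes from one observation: if `t` annihilates `X`, then `t` acts on `P₀` as a map factoring
through `f` (`exists_comp_eq_smul_id`), and dually there is `h : P₁* → P₀*` with `h φ = t`.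

* Since `X` is torsion, `t` may be taken to be a non-zero-divisor `s`. The associated primes of a
  module satisfying `(S_1)` are minimal primes of the ring, so `s` is regular on `M`
  (`SatisfiesSerre.isSMulRegular`), and `h φ = s` makes `φ` injective, also after tensoring
  with `M` (`lTensor_injective_of_comp_eq_smul_id`). Hence `0 → P₀* → P₁* → N → 0` is a projective
  resolution of `N` that stays exact after tensoring with `M`: all higher `Tor` vanish and `N` has
  projective dimension at most one.
* Away from `V(p)` the free module `X_q` is killed by a non-zero-divisor, so it vanishes and some
  `t ∉ q` annihilates `X`. There `h φ = t` splits `φ`, and `N_q` is flat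
  (`flat_localizedModule_of_comp_eq_smul_id`), so tensoring with it does not lower depth. On
  `V(p)` the depth lemma for `0 → M ⊗ P₀* → M ⊗ P₁* → M ⊗ N → 0` loses at most one
  (`le_moduleDepth_localized_tensorProduct`). The primes of `V(p)` in the support of `M` differ
  from `p` and have height at least `n + 2`, so `M ⊗ N` has `(S_(n+1))`; the same argument with
  `R` in place of `M` gives `(S_n)` for `N` (`SatisfiesSerre.tensorProduct`).
* At `p` the ring has depth exactly `n + 1`, while `depth N_p ≤ n`
  (`not_le_moduleDepth_localized_of_exact`). As `X_p ≠ 0`, some functional `a` on `P₀` is nonzero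
  modulo `p` although `φ a = a f` vanishes modulo `p` (`exists_dual_of_mem_support`). A nonzero
  class of `Ext^(n+1)(k, R_p)`, where `k` is the residue field of `p`, then yields, along `a`, a
  nonzero class in `Ext^(n+1)(k, P₀*_p)` that dies in `Ext^(n+1)(k, P₁*_p)`, so it comes from
  `Ext^n(k, N_p)`. Thus `(S_(n+1))` fails for `N`, and `N_p` is not flat, so `N` is not projective.

Depth enters through Rees' theorem, as the vanishing of `Ext` out of the residue field
(`le_moduleDepth_iff_subsingleton_ext`).
-/

open RingTheory.Sequence IsLocalRing Abelian TensorProduct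

/-! ### Grade of a module -/

section Grade

variable {R : Type u} [CommRing R] {M : Type v} [AddCommGroup M] [Module R M]

lemma le_moduleGrade_iff {I : Ideal R} {k : ℕ} :
    (k : ℕ∞) ≤ moduleGrade I M ↔
      ∃ rs : List R, k ≤ rs.length ∧ (∀ r ∈ rs, r ∈ I) ∧ IsWeaklyRegular M rs := by
  constructor
  · intro h
    by_contra! hcon
    rcases k with _ | k
    · exact hcon [] (Nat.zero_le _) (by simp) (IsWeaklyRegular.nil R M)
    · have hle : moduleGrade I M ≤ (k : ℕ∞) := by
        refine iSup₂_le fun rs hrs ↦ ?_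
        by_contra hlt
        exact hcon rs (by simpa using hlt) hrs.1 hrs.2
      exact absurd (h.trans hle) (by exact_mod_cast (Nat.lt_succ_self k).not_ge)
  · rintro ⟨rs, hk, hrs⟩
    exact le_trans (by exact_mod_cast hk)
      (le_iSup₂ (f := fun (rs : List R)
        (_ : (∀ r ∈ rs, r ∈ I) ∧ IsWeaklyRegular M rs) ↦ (rs.length : ℕ∞)) rs hrs)

lemma moduleGrade_congr {M' : Type*} [AddCommGroup M'] [Module R M'] (I : Ideal R)
    (e : M ≃ₗ[R] M') : moduleGrade I M = moduleGrade I M' := by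
  simp only [moduleGrade, e.isWeaklyRegular_congr]

/-- Tensoring with a flat module preserves weakly regular sequences, so it cannot lower the
grade. -/
lemma moduleGrade_le_tensorProduct_of_flat {F : Type*} [AddCommGroup F] [Module R F]
    [Module.Flat R F] (I : Ideal R) :
    moduleGrade I M ≤ moduleGrade I (TensorProduct R M F) :=
  iSup₂_le fun rs hrs ↦ le_iSup₂_of_le (f := fun (rs : List R)
    (_ : (∀ r ∈ rs, r ∈ I) ∧ IsWeaklyRegular (TensorProduct R M F) rs) ↦ (rs.length : ℕ∞)) rs
    ⟨hrs.1, hrs.2.isWeaklyRegular_rTensor⟩ le_rfl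

lemma moduleGrade_self_le_of_flat [Module.Flat R M] (I : Ideal R) :
    moduleGrade I R ≤ moduleGrade I M :=
  moduleGrade_le_tensorProduct_of_flat I |>.trans_eq
    (moduleGrade_congr I (TensorProduct.lid R M))

end Grade

/-! ### Depth and `Ext` -/

/-- The short exact sequence in `ModuleCat` of an injection followed by a surjection. -/
lemma ModuleCat.shortExact_of_injective_of_surjective {R : Type u} [Ring R] {A B C : Type u}
    [AddCommGroup A] [Module R A] [AddCommGroup B] [Module R B] [AddCommGroup C] [Module R C]
    {f : A →ₗ[R] B} {g : B →ₗ[R] C} (hf : Function.Injective f) (hfg : Function.Exact f g)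
    (hg : Function.Surjective g) :
    (ShortComplex.mk (ModuleCat.ofHom f) (ModuleCat.ofHom g)
      (by ext x; exact hfg.apply_apply_eq_zero x)).ShortExact where
  exact := (ShortComplex.ShortExact.moduleCat_exact_iff_function_exact _).mpr hfg
  mono_f := (ModuleCat.mono_iff_injective _).mpr hf
  epi_g := (ModuleCat.epi_iff_surjective _).mpr hg

/-- Every class in `Ext` out of the residue field dies along a homomorphism `S → B` taking `1`
into `𝔪 B`. -/
lemma ext_comp_toSpanSingleton_eq_zero {S : Type u} [CommRing S] [IsLocalRing S]
    {B : Type u} [AddCommGroup B] [Module S B] {i : ℕ}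
    (e : Ext (ModuleCat.of S (S ⧸ maximalIdeal S)) (ModuleCat.of S S) i) {b : B}
    (hb : b ∈ maximalIdeal S • (⊤ : Submodule S B)) :
    e.comp (Ext.mk₀ (ModuleCat.ofHom (LinearMap.toSpanSingleton S B b))) (add_zero i) = 0 := by
  induction hb using Submodule.smul_induction_on' with
  | smul r hr c _ =>
    have hmul : ModuleCat.ofHom (LinearMap.toSpanSingleton S B (r • c)) =
        (r • 𝟙 (ModuleCat.of S S)) ≫ ModuleCat.ofHom (LinearMap.toSpanSingleton S B c) := by
      ext
      simp
    have hzero := Ext.postcomp_smul_id_eq_zero_of_mem_annihilator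
      (N := ModuleCat.of S (S ⧸ maximalIdeal S)) (M := ModuleCat.of S S)
      (r := r) (by simpa [Ideal.annihilator_quotient] using hr) i
    have he : e.comp (Ext.mk₀ (r • 𝟙 (ModuleCat.of S S))) (add_zero i) = 0 :=
      congr($(hzero) e)
    rw [hmul, ← Ext.mk₀_comp_mk₀, ← Ext.comp_assoc_of_third_deg_zero, he, Ext.zero_comp]
  | add b _ c _ hb hc =>
    have hadd : ModuleCat.ofHom (LinearMap.toSpanSingleton S B (b + c)) =
        ModuleCat.ofHom (LinearMap.toSpanSingleton S B b) +
          ModuleCat.ofHom (LinearMap.toSpanSingleton S B c) := by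
      ext
      simp
    rw [hadd, Ext.mk₀_add, Ext.comp_add, hb, hc, add_zero]

section Depth

variable {S : Type u} [CommRing S] [IsLocalRing S] [IsNoetherianRing S]

/-- Rees' theorem for the residue field: depth is detected by the vanishing of `Ext`. The zero
module is included: there both sides hold for every `k`. -/
lemma le_moduleDepth_iff_subsingleton_ext (A : Type u) [AddCommGroup A] [Module S A]
    [Module.Finite S A] (k : ℕ) :
    (k : ℕ∞) ≤ moduleDepth S A ↔
      ∀ i < k, Subsingleton (Ext (ModuleCat.of S (S ⧸ maximalIdeal S)) (ModuleCat.of S A) i) := by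
  have hsupp : Module.support S (S ⧸ maximalIdeal S) =
      PrimeSpectrum.zeroLocus (maximalIdeal S) := by
    rw [Module.support_eq_zeroLocus, Ideal.annihilator_quotient]
  rw [moduleDepth, le_moduleGrade_iff]
  rcases subsingleton_or_nontrivial A with hA | hA
  · refine iff_of_true ⟨List.replicate k 0, by simp, ?_, ?_⟩ fun i _ ↦ ?_
    · intro r hr
      rw [List.eq_of_mem_replicate hr]
      exact zero_mem _
    · exact ⟨fun i hi ↦ Function.injective_of_subsingleton _⟩
    · have : Limits.IsZero (ModuleCat.of S A) := ModuleCat.isZero_of_subsingleton _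
      exact subsingleton_of_forall_eq 0 fun x ↦ by
        rw [← x.comp_mk₀_id, this.eq_of_src (𝟙 _) 0, Ext.mk₀_zero, Ext.comp_zero]
  · have hlt : maximalIdeal S • (⊤ : Submodule S A) < ⊤ :=
      (Submodule.top_ne_ideal_smul_of_le_jacobson_annihilator
        (maximalIdeal_le_jacobson _)).symm.lt_top
    constructor
    · rintro ⟨rs, hk, hrs, hreg⟩ i hi
      exact ModuleCat.subsingleton_ext_of_exists_isRegular (maximalIdeal S)
        (ModuleCat.of S (S ⧸ maximalIdeal S)) hsupp.subset (ModuleCat.of S A) hlt rs hrs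
        (IsRegular.of_isWeaklyRegular_of_mem_maximalIdeal _ hrs hreg) i (hi.trans_le hk)
    · intro h
      obtain ⟨rs, hl, hrs, hreg⟩ := ModuleCat.exists_isRegular_of_exists_subsingleton_ext
        (maximalIdeal S) k (ModuleCat.of S A) hlt (ModuleCat.of S (S ⧸ maximalIdeal S)) hsupp h
      exact ⟨rs, hl.ge, hrs, hreg.toIsWeaklyRegular⟩

/-- A sequence regular on the ring has length at most the Krull dimension. -/
lemma natCast_le_ringKrullDim_of_le_moduleDepth {k : ℕ} (h : (k : ℕ∞) ≤ moduleDepth S S) :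
    ((k : ℕ∞) : WithBot ℕ∞) ≤ ringKrullDim S := by
  obtain ⟨rs, hk, hrs, hreg⟩ := le_moduleGrade_iff.mp h
  have hreg' := IsRegular.of_isWeaklyRegular_of_mem_maximalIdeal _ hrs hreg
  rw [← ringKrullDim_add_length_eq_ringKrullDim_of_isRegular rs hreg']
  have : Nontrivial (S ⧸ Ideal.ofList rs) := by
    refine Ideal.Quotient.nontrivial_iff.mpr fun htop ↦ ?_
    refine (maximalIdeal.isMaximal S).ne_top (top_le_iff.mp (htop ▸ ?_))
    exact Ideal.span_le.mpr hrs
  calc ((k : ℕ∞) : WithBot ℕ∞) ≤ 0 + ((rs.length : ℕ∞) : WithBot ℕ∞) := by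
        rw [zero_add]; exact_mod_cast hk
    _ ≤ _ := by
        gcongr
        · exact ringKrullDim_nonneg_of_nontrivial
        · rfl

variable {A B C : Type u} [AddCommGroup A] [Module S A] [AddCommGroup B] [Module S B]
  [AddCommGroup C] [Module S C] [Module.Finite S C]

/-- The part of the depth lemma bounding the depth of a cokernel. -/
lemma le_moduleDepth_of_exact [Module.Finite S A] [Module.Finite S B] {f : A →ₗ[S] B}
    {g : B →ₗ[S] C} (hf : Function.Injective f) (hfg : Function.Exact f g)
    (hg : Function.Surjective g) {k : ℕ} (hA : ((k + 1 : ℕ) : ℕ∞) ≤ moduleDepth S A)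
    (hB : (k : ℕ∞) ≤ moduleDepth S B) :
    (k : ℕ∞) ≤ moduleDepth S C := by
  rw [le_moduleDepth_iff_subsingleton_ext] at hA hB ⊢
  intro i hi
  have h1 := hA (i + 1) (by omega)
  have h2 := hB i hi
  refine subsingleton_of_forall_eq 0 fun x ↦ ?_
  obtain ⟨y, rfl⟩ := Ext.covariant_sequence_exact₃ _
    (ModuleCat.shortExact_of_injective_of_surjective hf hfg hg) x rfl
    (Subsingleton.elim (h := h1) _ _)
  have hy : y = 0 := Subsingleton.elim (h := h2) _ _
  simp [hy]

/-- If `0 → A → B → C → 0` is exact, the depth of `S` is exactly `t + 1`, and some `a` generating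
a direct summand `S` of `A` is sent into `𝔪 B`, then `depth C ≤ t`: a nonzero class in
`Ext^(t+1)(k, S)` gives one in `Ext^(t+1)(k, A)` that dies in `Ext^(t+1)(k, B)`, hence comes from
`Ext^t(k, C)`. -/
lemma not_le_moduleDepth_of_exact {f : A →ₗ[S] B} {g : B →ₗ[S] C} (hf : Function.Injective f)
    (hfg : Function.Exact f g) (hg : Function.Surjective g) {t : ℕ}
    (hS : ((t + 1 : ℕ) : ℕ∞) ≤ moduleDepth S S) (hS' : ¬ ((t + 2 : ℕ) : ℕ∞) ≤ moduleDepth S S)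
    {a : A} (ha : f a ∈ maximalIdeal S • (⊤ : Submodule S B)) {θ : A →ₗ[S] S} (hθ : θ a = 1) :
    ¬ ((t + 1 : ℕ) : ℕ∞) ≤ moduleDepth S C := by
  intro hC
  rw [le_moduleDepth_iff_subsingleton_ext] at hS hS' hC
  refine hS' fun i hi ↦ ?_
  obtain hi | rfl : i < t + 1 ∨ i = t + 1 := by omega
  · exact hS i hi
  have h1 := hC t (by omega)
  refine subsingleton_of_forall_eq 0 fun e ↦ ?_
  set x := e.comp (Ext.mk₀ (ModuleCat.ofHom (LinearMap.toSpanSingleton S A a))) (add_zero _)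
    with hx
  have hxf : x.comp (Ext.mk₀ (ModuleCat.ofHom f)) (add_zero _) = 0 := by
    have hcomp : ModuleCat.ofHom (LinearMap.toSpanSingleton S A a) ≫ ModuleCat.ofHom f =
        ModuleCat.ofHom (LinearMap.toSpanSingleton S B (f a)) := by
      ext
      simp
    rw [hx, Ext.comp_assoc_of_third_deg_zero, Ext.mk₀_comp_mk₀, hcomp]
    exact ext_comp_toSpanSingleton_eq_zero e ha
  obtain ⟨y, hy⟩ := Ext.covariant_sequence_exact₁ _
    (ModuleCat.shortExact_of_injective_of_surjective hf hfg hg) x hxf rfl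
  have hx0 : x = 0 := by
    rw [← hy, Subsingleton.elim (h := h1) y 0, Ext.zero_comp]
  have hid : ModuleCat.ofHom (LinearMap.toSpanSingleton S A a) ≫ ModuleCat.ofHom θ =
      𝟙 (ModuleCat.of S S) := by
    ext
    simp [hθ]
  calc e = e.comp (Ext.mk₀ (𝟙 (ModuleCat.of S S))) (add_zero _) := by simp
    _ = x.comp (Ext.mk₀ (ModuleCat.ofHom θ)) (add_zero _) := by
      rw [← hid, ← Ext.mk₀_comp_mk₀, ← Ext.comp_assoc_of_third_deg_zero]
    _ = 0 := by rw [hx0, Ext.zero_comp]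

end Depth

/-! ### Maps that split up to a scalar -/

section Homotopy

variable {R : Type u} [CommRing R]

/-- An element annihilating the cokernel of `f` acts on the projective target of `f` as a map
factoring through `f`. -/
lemma exists_comp_eq_smul_id {P Q X : Type*} [AddCommGroup P] [Module R P] [AddCommGroup Q]
    [Module R Q] [Module.Projective R Q] [AddCommGroup X] [Module R X] {f : P →ₗ[R] Q}
    {g : Q →ₗ[R] X} (hfg : Function.Exact f g) {t : R} (ht : t ∈ Module.annihilator R X) :
    ∃ h : Q →ₗ[R] P, f ∘ₗ h = t • LinearMap.id := by
  have hmem (y : Q) : t • y ∈ LinearMap.range f := by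
    refine (hfg _).mp ?_
    rw [map_smul]
    exact Module.mem_annihilator.mp ht _
  obtain ⟨h, hh⟩ := Module.projective_lifting_property f.rangeRestrict
    ((t • LinearMap.id).codRestrict (LinearMap.range f) hmem) f.surjective_rangeRestrict
  refine ⟨h, LinearMap.ext fun y ↦ ?_⟩
  simpa using congr(($hh y : Q))

variable {F G N : Type*} [AddCommGroup F] [Module R F] [AddCommGroup G] [Module R G]
  [AddCommGroup N] [Module R N] {φ : F →ₗ[R] G} {ψ : G →ₗ[R] N} {h : G →ₗ[R] F} {s : R}

lemma lTensor_injective_of_comp_eq_smul_id (hs : h ∘ₗ φ = s • LinearMap.id) [Module.Flat R F]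
    {M : Type*} [AddCommGroup M] [Module R M] (hM : IsSMulRegular M s) :
    Function.Injective (φ.lTensor M) := by
  have hcomp : (h.lTensor M) ∘ₗ (φ.lTensor M) = s • LinearMap.id := by
    rw [← LinearMap.lTensor_comp, hs, LinearMap.lTensor_smul, LinearMap.lTensor_id]
  have hreg : IsSMulRegular (M ⊗[R] F) s := hM.rTensor F
  refine Function.Injective.of_comp (f := h.lTensor M) fun x y hxy ↦ hreg ?_
  simpa using (LinearMap.congr_fun hcomp x).symm.trans (hxy.trans (LinearMap.congr_fun hcomp y))

/-- If `φ` splits up to the scalar `t`, then its cokernel is a direct summand of `G` wherever `t`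
is invertible: `t - φ h` descends to a map from the cokernel to `G`. -/
lemma flat_localizedModule_of_comp_eq_smul_id (hs : h ∘ₗ φ = s • LinearMap.id)
    (hφψ : Function.Exact φ ψ) (hψ : Function.Surjective ψ) [Module.Flat R G]
    (q : Ideal R) [q.IsPrime] (hq : s ∉ q) :
    Module.Flat (Localization.AtPrime q) (LocalizedModule q.primeCompl N) := by
  obtain ⟨σ, hσ⟩ : ∃ σ : N →ₗ[R] G, ψ ∘ₗ σ = s • LinearMap.id := by
    let e := hφψ.linearEquivOfSurjective hψ
    let τ : G →ₗ[R] G := s • LinearMap.id - φ ∘ₗ h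
    have hτ : LinearMap.range φ ≤ LinearMap.ker τ := by
      rintro _ ⟨x, rfl⟩
      have := LinearMap.congr_fun hs x
      simp only [LinearMap.coe_comp, Function.comp_apply] at this
      simp [τ, this]
    refine ⟨(LinearMap.range φ).liftQ τ hτ ∘ₗ e.symm.toLinearMap, ?_⟩
    refine (LinearMap.cancel_right hψ).mp (LinearMap.ext fun y ↦ ?_)
    have hy : e.symm (ψ y) = (LinearMap.range φ).mkQ y := by
      rw [LinearEquiv.symm_apply_eq]
      rfl
    simp [hy, τ, hφψ.apply_apply_eq_zero]
  let u : (Localization.AtPrime q)ˣ := IsUnit.unit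
    (IsLocalization.map_units (Localization.AtPrime q) (⟨s, hq⟩ : q.primeCompl))
  refine Module.Flat.of_retract (M := LocalizedModule q.primeCompl G)
    (LocalizedModule.map q.primeCompl σ)
    ((u⁻¹ : (Localization.AtPrime q)ˣ) • LocalizedModule.map q.primeCompl ψ) ?_
  refine LinearMap.ext fun x ↦ ?_
  induction x using LocalizedModule.induction_on with
  | h m t =>
    have hm : ψ (σ m) = s • m := LinearMap.congr_fun hσ m
    simp only [LinearMap.comp_apply, LinearMap.smul_apply, LocalizedModule.map_mk, hm,
      LinearMap.id_apply]
    rw [inv_smul_eq_iff, Units.smul_def]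
    simp only [u, IsUnit.unit_spec]
    rw [algebraMap_smul, LocalizedModule.smul'_mk]

end Homotopy

/-! ### Localization and depth of tensor products -/

section Localization

variable {R : Type u} [CommRing R] (q : Ideal R) [q.IsPrime]

/-- Localization at a prime commutes with tensor products. -/
noncomputable def localizedModuleTensorEquiv (M F : Type u) [AddCommGroup M] [Module R M]
    [AddCommGroup F] [Module R F] :
    LocalizedModule q.primeCompl (M ⊗[R] F) ≃ₗ[Localization.AtPrime q]
      LocalizedModule q.primeCompl M ⊗[Localization.AtPrime q] LocalizedModule q.primeCompl F :=
  LocalizedModule.equivTensorProduct q.primeCompl (M ⊗[R] F) ≪≫ₗ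
    AlgebraTensorModule.distribBaseChange R (Localization.AtPrime q) M F ≪≫ₗ
    TensorProduct.congr (LocalizedModule.equivTensorProduct q.primeCompl M).symm
      (LocalizedModule.equivTensorProduct q.primeCompl F).symm

/-- The localization of a module at a prime respects isomorphisms. -/
noncomputable def localizedModuleCongr {M F : Type*} [AddCommGroup M] [Module R M]
    [AddCommGroup F] [Module R F] (e : M ≃ₗ[R] F) :
    LocalizedModule q.primeCompl M ≃ₗ[Localization.AtPrime q] LocalizedModule q.primeCompl F :=
  IsLocalizedModule.mapEquiv q.primeCompl (LocalizedModule.mkLinearMap q.primeCompl M)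
    (LocalizedModule.mkLinearMap q.primeCompl F) (Localization.AtPrime q) e

/-- The localization of the ring as a module is the localized ring. -/
noncomputable def localizedModuleSelfEquiv :
    LocalizedModule q.primeCompl R ≃ₗ[Localization.AtPrime q] Localization.AtPrime q :=
  LocalizedModule.equivTensorProduct q.primeCompl R ≪≫ₗ
    AlgebraTensorModule.rid R (Localization.AtPrime q) (Localization.AtPrime q)

variable {q} {M F G N : Type u} [AddCommGroup M] [Module R M] [AddCommGroup F] [Module R F]
  [AddCommGroup G] [Module R G] [AddCommGroup N] [Module R N]

lemma moduleDepth_le_localized_tensorProduct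
    [Module.Flat (Localization.AtPrime q) (LocalizedModule q.primeCompl F)] :
    moduleDepth (Localization.AtPrime q) (LocalizedModule q.primeCompl M) ≤
      moduleDepth (Localization.AtPrime q) (LocalizedModule q.primeCompl (M ⊗[R] F)) :=
  (moduleGrade_le_tensorProduct_of_flat _).trans_eq
    (moduleGrade_congr _ (localizedModuleTensorEquiv q M F)).symm

/-- Tensoring `0 → F → G → N → 0` with `M`, where `F` and `G` are flat and exactness is kept,
loses at most one unit of depth. -/
lemma le_moduleDepth_localized_tensorProduct [IsNoetherianRing R] [Module.Finite R M]
    [Module.Finite R F] [Module.Flat R F] [Module.Finite R G] [Module.Flat R G]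
    [Module.Finite R N] {φ : F →ₗ[R] G} {ψ : G →ₗ[R] N} (hφ : Function.Injective (φ.lTensor M))
    (hφψ : Function.Exact φ ψ) (hψ : Function.Surjective ψ) {k : ℕ}
    (hk : ((k + 1 : ℕ) : ℕ∞) ≤
      moduleDepth (Localization.AtPrime q) (LocalizedModule q.primeCompl M)) :
    (k : ℕ∞) ≤
      moduleDepth (Localization.AtPrime q) (LocalizedModule q.primeCompl (M ⊗[R] N)) :=
  le_moduleDepth_of_exact (g := LocalizedModule.map q.primeCompl (ψ.lTensor M))
    (LocalizedModule.map_injective q.primeCompl _ hφ)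
    (LocalizedModule.map_exact q.primeCompl _ _ (lTensor_exact M hφψ hψ))
    (LocalizedModule.map_surjective q.primeCompl _ (LinearMap.lTensor_surjective M hψ))
    (hk.trans moduleDepth_le_localized_tensorProduct)
    ((Nat.cast_le.mpr k.le_succ).trans (hk.trans moduleDepth_le_localized_tensorProduct))

lemma SatisfiesSerre.congr {k : ℕ} (e : M ≃ₗ[R] N) (h : SatisfiesSerre R M k) :
    SatisfiesSerre R N k := by
  intro q hq
  rw [← e.support_eq] at hq
  refine (h q hq).trans_eq ?_
  exact congrArg _ (moduleGrade_congr _ (localizedModuleCongr q.asIdeal e))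

lemma mem_support_of_mem_support_tensorProduct {q : PrimeSpectrum R}
    (hq : q ∈ Module.support R (M ⊗[R] N)) : q ∈ Module.support R M := by
  rw [Module.mem_support_iff] at hq ⊢
  by_contra hM
  rw [not_nontrivial_iff_subsingleton] at hM
  have := (localizedModuleTensorEquiv q.asIdeal M N).subsingleton_congr.mpr inferInstance
  exact not_nontrivial _ hq

end Localization

/-! ### Associated primes and Serre's condition -/

section AssociatedPrimes

variable {R : Type u} [CommRing R] [IsNoetherianRing R] {M : Type v} [AddCommGroup M] [Module R M]

lemma not_one_le_moduleDepth_of_mem_associatedPrimes {q : Ideal R} [q.IsPrime]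
    (hq : q ∈ associatedPrimes R M) :
    ¬ ((1 : ℕ) : ℕ∞) ≤
      moduleDepth (Localization.AtPrime q) (LocalizedModule q.primeCompl M) := by
  intro hd
  obtain ⟨rs, hl, hrs, hreg⟩ := le_moduleGrade_iff.mp hd
  obtain _ | ⟨r, rs⟩ := rs
  · simp at hl
  have hr : IsSMulRegular (LocalizedModule q.primeCompl M) r :=
    ((isWeaklyRegular_cons_iff _ r rs).mp hreg).1
  obtain ⟨-, x, hx⟩ := isAssociatedPrime_iff.mp hq
  have hmem (a : R) : a ∈ q ↔ a • x = 0 := by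
    rw [hx, Submodule.mem_colon_singleton, Submodule.mem_bot]
  have hrq : r ∈ maximalIdeal (Localization.AtPrime q) := hrs r List.mem_cons_self
  obtain ⟨a, t, rfl⟩ := IsLocalization.exists_mk'_eq q.primeCompl r
  rw [IsLocalization.AtPrime.mk'_mem_maximal_iff (Localization.AtPrime q) q, hmem] at hrq
  have hzero : (LocalizedModule.mk x 1 : LocalizedModule q.primeCompl M) = 0 := by
    refine hr ?_
    simp only [smul_zero]
    rw [← Localization.mk_eq_mk', LocalizedModule.mk_smul_mk, hrq, LocalizedModule.zero_mk]
  rw [← LocalizedModule.zero_mk 1, LocalizedModule.mk_eq] at hzero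
  obtain ⟨c, hc⟩ := hzero
  exact c.2 ((hmem c).mpr (by simpa [Submonoid.smul_def] using hc))

/-- The associated primes of a module with `(S_1)` are minimal primes of the ring, so
non-zero-divisors of the ring are regular on the module. -/
lemma SatisfiesSerre.isSMulRegular {k : ℕ} (hM : SatisfiesSerre R M (k + 1))
    {s : R} (hs : s ∈ nonZeroDivisors R) : IsSMulRegular M s := by
  by_contra hreg
  have hmem : s ∈ ⋃ q ∈ associatedPrimes R M, (q : Set R) := by
    rw [biUnion_associatedPrimes_eq_compl_regular R]
    exact hreg
  simp only [Set.mem_iUnion, SetLike.mem_coe, exists_prop] at hmem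
  obtain ⟨q, hq, hsq⟩ := hmem
  have hprime := hq.isPrime
  have hsupp : (⟨q, hprime⟩ : PrimeSpectrum R) ∈ Module.support R M := by
    obtain ⟨-, x, hx⟩ := isAssociatedPrime_iff.mp hq
    refine Module.mem_support_iff'.mpr ⟨x, fun r hr h0 ↦ hr ?_⟩
    change r ∈ q
    rwa [hx, Submodule.mem_colon_singleton, Submodule.mem_bot]
  have hd := not_one_le_moduleDepth_of_mem_associatedPrimes hq
  have hle := hM ⟨q, hprime⟩ hsupp
  have hq0 : q.height = 0 := by
    rw [IsLocalization.AtPrime.ringKrullDim_eq_height q] at hle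
    by_contra hne
    refine hd (WithBot.coe_le_coe.mp (le_trans (le_min ?_ ?_) hle))
    · exact_mod_cast Nat.le_add_left 1 k
    · exact_mod_cast Order.one_le_iff_ne_zero.mpr hne
  have hmin : q ∈ (Module.annihilator R R).minimalPrimes := by
    rw [Module.annihilator_eq_bot.mpr inferInstance]
    exact Ideal.height_eq_zero_iff.mp hq0
  exact IsSMulRegular.notMem_of_mem_minimalPrimes
    (Module.Flat.isSMulRegular_of_nonZeroDivisors hs) hmin hsq

end AssociatedPrimes

/-! ### Functionals on projective modules -/

section Dual

variable {R : Type u} [CommRing R]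

lemma mem_smul_top_dual {P : Type*} [AddCommGroup P] [Module R P] [Module.Finite R P]
    [Module.Projective R P] {I : Ideal R} {b : Module.Dual R P} (hb : ∀ y, b y ∈ I) :
    b ∈ I • (⊤ : Submodule R (Module.Dual R P)) := by
  obtain ⟨n, f, g, -, -, hfg⟩ := Module.Finite.exists_comp_eq_id_of_projective R P
  have hsum : b = ∑ i, b (f (Pi.single i 1)) • (LinearMap.proj i ∘ₗ g) := by
    ext y
    conv_lhs => rw [← LinearMap.id_apply (R := R) y, ← hfg, LinearMap.comp_apply,
      ← Finset.univ_sum_single (g y)]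
    simp only [map_sum, LinearMap.sum_apply, LinearMap.smul_apply, LinearMap.comp_apply,
      LinearMap.proj_apply, smul_eq_mul]
    refine Finset.sum_congr rfl fun i _ ↦ ?_
    rw [← mul_one (g y i), ← smul_eq_mul, Pi.single_smul, map_smul, map_smul, smul_eq_mul,
      smul_eq_mul, mul_one, mul_comm]
  rw [hsum]
  exact Submodule.sum_mem _ fun i _ ↦ Submodule.smul_mem_smul (hb _) trivial

lemma exists_linearMap_residue_ne_zero (S A : Type*) [CommRing S] [IsLocalRing S] [AddCommGroup A]
    [Module S A] [Module.Finite S A] [Nontrivial A] :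
    ∃ l : A →ₗ[S] S ⧸ maximalIdeal S, l ≠ 0 := by
  obtain ⟨N, hN, -⟩ := (eq_top_or_exists_le_coatom (⊥ : Submodule S A)).resolve_left bot_ne_top
  obtain ⟨I, hI, ⟨e⟩⟩ := isSimpleModule_iff_quot_maximal.mp (isSimpleModule_iff_isCoatom.mpr hN)
  obtain rfl := IsLocalRing.eq_maximalIdeal hI
  refine ⟨e.toLinearMap ∘ₗ N.mkQ, fun h0 ↦ hN.1 (eq_top_iff.mpr fun z _ ↦ ?_)⟩
  simpa using LinearMap.congr_fun h0 z

/-- A map from a finite projective module to the residue field of a prime `p` comes from a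
functional, up to a denominator outside `p`. -/
lemma exists_dual_mem_iff {Q S : Type*} [AddCommGroup Q] [Module R Q] [Module.Finite R Q]
    [Module.Projective R Q] (p : Ideal R) [p.IsPrime] [CommRing S] [Algebra R S] [IsLocalRing S]
    [IsLocalization.AtPrime S p] (l : Q →ₗ[R] S ⧸ maximalIdeal S) :
    ∃ a : Module.Dual R Q, ∀ y, a y ∈ p ↔ l y = 0 := by
  obtain ⟨h, hh⟩ := Module.projective_lifting_property
    (Ideal.Quotient.mkₐ R (maximalIdeal S)).toLinearMap l Ideal.Quotient.mk_surjective
  have := Module.finitePresentation_of_projective R Q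
  obtain ⟨a, s, ha⟩ := Module.FinitePresentation.exists_lift_of_isLocalizedModule
    p.primeCompl (Algebra.linearMap R S) h
  refine ⟨a, fun y ↦ ?_⟩
  have hy : algebraMap R S (a y) = algebraMap R S s * h y := by
    rw [← Algebra.smul_def]
    exact LinearMap.congr_fun ha y
  rw [← IsLocalization.AtPrime.to_map_mem_maximal_iff S p, hy,
    Ideal.unit_mul_mem_iff_mem _ (IsLocalization.map_units S s), ← hh]
  exact Ideal.Quotient.eq_zero_iff_mem.symm

/-- If `p` lies in the support of the cokernel of `f : P → Q`, some functional on `Q` becomes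
trivial modulo `p` on `P` but not on `Q`: lift a nonzero map from the localized cokernel to the
residue field of `p`, and clear denominators. -/
lemma exists_dual_of_mem_support {P Q X : Type u} [AddCommGroup P] [Module R P]
    [AddCommGroup Q] [Module R Q] [Module.Finite R Q] [Module.Projective R Q]
    [AddCommGroup X] [Module R X] {f : P →ₗ[R] Q}
    {g : Q →ₗ[R] X} (hfg : Function.Exact f g) (hg : Function.Surjective g)
    {p : PrimeSpectrum R} (hp : p ∈ Module.support R X) :
    ∃ (a : Module.Dual R Q) (x : Q), (∀ y, a (f y) ∈ p.asIdeal) ∧ a x ∉ p.asIdeal := by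
  have := Module.Finite.of_surjective g hg
  have := Module.mem_support_iff.mp hp
  obtain ⟨l₀, hl₀⟩ := exists_linearMap_residue_ne_zero (Localization.AtPrime p.asIdeal)
    (LocalizedModule p.asIdeal.primeCompl X)
  obtain ⟨a, ha⟩ := exists_dual_mem_iff p.asIdeal
    (l₀.restrictScalars R ∘ₗ LocalizedModule.mkLinearMap p.asIdeal.primeCompl X ∘ₗ g)
  obtain ⟨x, hx⟩ : ∃ x, l₀ (LocalizedModule.mk (g x) 1) ≠ 0 := by
    by_contra! hall
    refine hl₀ (LinearMap.ext fun z ↦ ?_)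
    induction z using LocalizedModule.induction_on with
    | h m t =>
      obtain ⟨y, rfl⟩ := hg m
      have hy : l₀ (LocalizedModule.mk (g y) 1) = 0 := hall y
      have : (LocalizedModule.mk (g y) t : LocalizedModule p.asIdeal.primeCompl X) =
          (Localization.mk 1 t : Localization.AtPrime p.asIdeal) •
            LocalizedModule.mk (g y) 1 := by
        rw [LocalizedModule.mk_smul_mk, one_smul, mul_one]
      rw [this, map_smul, hy, smul_zero, LinearMap.zero_apply]
  refine ⟨a, x, fun y ↦ (ha _).mpr ?_, fun h0 ↦ hx ((ha x).mp h0)⟩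
  rw [LinearMap.comp_apply, LinearMap.comp_apply, hfg.apply_apply_eq_zero, map_zero, map_zero]

end Dual

/-! ### Projective resolutions of length one -/

section TwoTerm

variable {R : Type u} [CommRing R] {A B N : Type u} [AddCommGroup A] [Module R A]
  [AddCommGroup B] [Module R B] [AddCommGroup N] [Module R N]

/-- The terms of the two-term complex `A → B`, with `B` in degree `0`. -/
def twoTermObj (R : Type u) [CommRing R] (A B : Type u) [AddCommGroup A] [Module R A]
    [AddCommGroup B] [Module R B] : ℕ → ModuleCat.{u} R
  | 0 => ModuleCat.of R B
  | 1 => ModuleCat.of R A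
  | _ + 2 => ModuleCat.of R PUnit

/-- The differentials of the two-term complex `A → B`. -/
def twoTermD (φ : A →ₗ[R] B) : ∀ n, twoTermObj R A B (n + 1) ⟶ twoTermObj R A B n
  | 0 => ModuleCat.ofHom φ
  | _ + 1 => 0

/-- The two-term complex `A → B`, with `B` in degree `0`. -/
noncomputable def twoTermComplex (φ : A →ₗ[R] B) : ChainComplex (ModuleCat.{u} R) ℕ :=
  ChainComplex.of (twoTermObj R A B) (twoTermD φ) fun n ↦ by
    cases n <;> exact Limits.zero_comp

lemma twoTermComplex_d_one_zero (φ : A →ₗ[R] B) :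
    (twoTermComplex φ).d 1 0 = ModuleCat.ofHom φ :=
  ChainComplex.of_d (twoTermObj R A B) (twoTermD φ) 0

lemma isZero_twoTermComplex_X (φ : A →ₗ[R] B) (n : ℕ) :
    Limits.IsZero ((twoTermComplex φ).X (n + 2)) :=
  ModuleCat.isZero_of_subsingleton (ModuleCat.of R PUnit)

/-- After applying an additive functor, the two-term complex is exact in positive degrees as soon
as its differential becomes injective. -/
lemma exactAt_map_twoTermComplex (φ : A →ₗ[R] B) (T : ModuleCat.{u} R ⥤ ModuleCat.{u} R)
    [T.Additive] (hT : Mono (T.map (ModuleCat.ofHom φ))) (i : ℕ) :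
    ((T.mapHomologicalComplex _).obj (twoTermComplex φ)).ExactAt (i + 1) := by
  rw [HomologicalComplex.exactAt_iff' _ (i + 2) (i + 1) i (by simp) (by simp)]
  obtain _ | i := i
  · refine (ShortComplex.exact_iff_mono _ ?_).mpr ?_
    · exact (T.map_isZero (isZero_twoTermComplex_X φ 0)).eq_zero_of_src _
    · change Mono (T.map ((twoTermComplex φ).d 1 0))
      rw [twoTermComplex_d_one_zero]
      exact hT
  · exact ShortComplex.exact_of_isZero_X₂ _ (T.map_isZero (isZero_twoTermComplex_X φ i))

lemma exactAt_twoTermComplex (φ : A →ₗ[R] B) (hφ : Function.Injective φ) (i : ℕ) :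
    (twoTermComplex φ).ExactAt (i + 1) := by
  rw [HomologicalComplex.exactAt_iff' _ (i + 2) (i + 1) i (by simp) (by simp)]
  obtain _ | i := i
  · refine (ShortComplex.exact_iff_mono _ ?_).mpr ?_
    · exact (isZero_twoTermComplex_X φ 0).eq_zero_of_src _
    · change Mono ((twoTermComplex φ).d 1 0)
      rw [twoTermComplex_d_one_zero]
      exact (ModuleCat.mono_iff_injective _).mpr hφ
  · exact ShortComplex.exact_of_isZero_X₂ _ (isZero_twoTermComplex_X φ i)

/-- The augmentation of the two-term complex `A → B` to its cokernel `N`. -/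
noncomputable def twoTermAugmentation {φ : A →ₗ[R] B} {ψ : B →ₗ[R] N}
    (hφψ : Function.Exact φ ψ) :
    twoTermComplex φ ⟶ (ChainComplex.single₀ (ModuleCat.{u} R)).obj (ModuleCat.of R N) :=
  (ChainComplex.toSingle₀Equiv _ _).symm ⟨ModuleCat.ofHom ψ, by
    rw [twoTermComplex_d_one_zero]
    ext x
    exact hφψ.apply_apply_eq_zero x⟩

lemma quasiIso_twoTermAugmentation {φ : A →ₗ[R] B} {ψ : B →ₗ[R] N}
    (hφ : Function.Injective φ) (hφψ : Function.Exact φ ψ) (hψ : Function.Surjective ψ) :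
    QuasiIso (twoTermAugmentation hφψ) where
  quasiIsoAt m := by
    obtain _ | m := m
    · rw [ChainComplex.quasiIsoAt₀_iff, ShortComplex.quasiIso_iff_of_zeros' _ rfl rfl rfl]
      refine (ShortComplex.exact_and_epi_g_iff_of_iso
        (ShortComplex.isoMk (Iso.refl _) (Iso.refl _) (Iso.refl _) ?_ ?_)).mp
        ⟨(ModuleCat.shortExact_of_injective_of_surjective hφ hφψ hψ).exact,
          (ModuleCat.shortExact_of_injective_of_surjective hφ hφψ hψ).epi_g⟩
      · exact (Category.id_comp _).trans
          ((twoTermComplex_d_one_zero φ).trans (Category.comp_id _).symm)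
      · exact (Category.id_comp _).trans
          ((ChainComplex.toSingle₀Equiv_symm_apply_f_zero _ _).trans (Category.comp_id _).symm)
    · rw [quasiIsoAt_iff_exactAt' (hL := ChainComplex.exactAt_succ_single_obj ..)]
      exact exactAt_twoTermComplex φ hφ m

/-- A projective resolution of length one. -/
noncomputable def twoTermResolution [Module.Projective R A] [Module.Projective R B]
    {φ : A →ₗ[R] B} {ψ : B →ₗ[R] N}
    (hφ : Function.Injective φ) (hφψ : Function.Exact φ ψ) (hψ : Function.Surjective ψ) :
    ProjectiveResolution (ModuleCat.of R N) where
  complex := twoTermComplex φ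
  projective
    | 0 => inferInstanceAs (Projective (ModuleCat.of R B))
    | 1 => inferInstanceAs (Projective (ModuleCat.of R A))
    | n + 2 => (isZero_twoTermComplex_X φ n).projective
  π := twoTermAugmentation hφψ
  quasiIso := quasiIso_twoTermAugmentation hφ hφψ hψ

lemma isZero_Tor_of_lTensor_injective [Module.Projective R A] [Module.Projective R B]
    {φ : A →ₗ[R] B} {ψ : B →ₗ[R] N}
    (hφ : Function.Injective φ) (hφψ : Function.Exact φ ψ) (hψ : Function.Surjective ψ)
    {M : Type u} [AddCommGroup M] [Module R M] (hM : Function.Injective (φ.lTensor M)) (i : ℕ) :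
    Limits.IsZero
      (((Tor (ModuleCat.{u} R) (i + 1)).obj (ModuleCat.of R M)).obj (ModuleCat.of R N)) := by
  refine Limits.IsZero.of_iso ?_ ((twoTermResolution hφ hφψ hψ).isoLeftDerivedObj
    ((MonoidalCategory.tensoringLeft (ModuleCat.{u} R)).obj (ModuleCat.of R M)) (i + 1))
  refine (HomologicalComplex.exactAt_iff_isZero_homology _ _).mp
    (exactAt_map_twoTermComplex φ _ ?_ i)
  exact (ModuleCat.mono_iff_injective _).mpr hM

lemma projectiveDimension_eq_one [Module.Projective R A] [Module.Projective R B]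
    {φ : A →ₗ[R] B} {ψ : B →ₗ[R] N}
    (hφ : Function.Injective φ) (hφψ : Function.Exact φ ψ) (hψ : Function.Surjective ψ)
    (hN : ¬ Module.Projective R N) : projectiveDimension (ModuleCat.of R N) = 1 := by
  have hB : Projective (ModuleCat.of R B) := inferInstance
  have hA : Projective (ModuleCat.of R A) := inferInstance
  apply le_antisymm
  · rw [← Nat.cast_one, projectiveDimension_le_iff]
    exact ((ModuleCat.shortExact_of_injective_of_surjective hφ hφψ
      hψ).hasProjectiveDimensionLT_X₃_iff 0 hB).mpr
        (projective_iff_hasProjectiveDimensionLT_one.mp hA)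
  · rw [← Nat.cast_one, projectiveDimension_ge_iff, ← projective_iff_hasProjectiveDimensionLT_one]
    exact fun h ↦ hN ((IsProjective.iff_projective N).mpr h)

end TwoTerm

/-! ### The transpose of a torsion module -/

section Transpose

variable {R : Type u} [CommRing R]

lemma annihilator_not_le_of_free_localizedModule {X : Type v} [AddCommGroup X] [Module R X]
    [Module.Finite R X] {s : R} (hs : s ∈ nonZeroDivisors R) (hsX : s ∈ Module.annihilator R X)
    (q : PrimeSpectrum R)
    (hfree : Module.Free (Localization.AtPrime q.asIdeal)
      (LocalizedModule q.asIdeal.primeCompl X)) :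
    ¬ Module.annihilator R X ≤ q.asIdeal := by
  rw [← Module.mem_support_iff_of_finite, Module.mem_support_iff]
  intro hnt
  have hreg : IsSMulRegular (LocalizedModule q.asIdeal.primeCompl X)
      (algebraMap R (Localization.AtPrime q.asIdeal) s) :=
    Module.Flat.isSMulRegular_of_nonZeroDivisors
      (IsLocalization.map_nonZeroDivisors_le q.asIdeal.primeCompl _ ⟨s, hs, rfl⟩)
  obtain ⟨z, hz⟩ := exists_ne (0 : LocalizedModule q.asIdeal.primeCompl X)
  refine hz (hreg ?_)
  induction z using LocalizedModule.induction_on with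
  | h m t =>
    simp only [smul_zero]
    rw [algebraMap_smul, LocalizedModule.smul'_mk, Module.mem_annihilator.mp hsX,
      LocalizedModule.zero_mk]

/-- Passing from `M` to `M ⊗ N`, where `N` has a resolution of length one that stays exact after
tensoring with `M` and is locally flat away from `V(p)`, costs one degree in Serre's condition,
provided the primes in `V(p)` that matter are large enough. -/
lemma SatisfiesSerre.tensorProduct [IsNoetherianRing R] {M F G N : Type u} [AddCommGroup M]
    [Module R M] [AddCommGroup F] [Module R F] [AddCommGroup G] [Module R G] [AddCommGroup N]
    [Module R N] [Module.Finite R M] [Module.Finite R F] [Module.Flat R F] [Module.Finite R G]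
    [Module.Flat R G] [Module.Finite R N] {φ : F →ₗ[R] G} {ψ : G →ₗ[R] N}
    (hφ : Function.Injective (φ.lTensor M)) (hφψ : Function.Exact φ ψ)
    (hψ : Function.Surjective ψ) {p : Ideal R}
    (hflat : ∀ q : PrimeSpectrum R, ¬ p ≤ q.asIdeal →
      Module.Flat (Localization.AtPrime q.asIdeal) (LocalizedModule q.asIdeal.primeCompl N))
    {k : ℕ} (hk : ∀ q ∈ Module.support R M, p ≤ q.asIdeal →
      ((k + 1 : ℕ) : ℕ∞) ≤ q.asIdeal.height) (hM : SatisfiesSerre R M (k + 1)) :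
    SatisfiesSerre R (M ⊗[R] N) k := by
  intro q hq
  have hqM := mem_support_of_mem_support_tensorProduct hq
  have hMq := hM q hqM
  by_cases hpq : p ≤ q.asIdeal
  · refine (min_le_left _ _).trans (WithBot.coe_le_coe.mpr ?_)
    refine le_moduleDepth_localized_tensorProduct hφ hφψ hψ (WithBot.coe_le_coe.mp ?_)
    refine le_trans (le_min le_rfl ?_) hMq
    rw [IsLocalization.AtPrime.ringKrullDim_eq_height q.asIdeal]
    exact WithBot.coe_le_coe.mpr (hk q hqM hpq)
  · have := hflat q hpq
    refine le_trans (min_le_min_right _ ?_)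
      (hMq.trans (WithBot.coe_le_coe.mpr moduleDepth_le_localized_tensorProduct))
    exact_mod_cast k.le_succ

/-- The localization at `p` of `not_le_moduleDepth_of_exact`: the functional `θ` with `θ a ∉ p`
shows that `a` generates a free direct summand of the localization of `F`. -/
lemma not_le_moduleDepth_localized_of_exact [IsNoetherianRing R] {F G N : Type u} [AddCommGroup F]
    [Module R F] [AddCommGroup G] [Module R G] [AddCommGroup N] [Module R N] [Module.Finite R N]
    {φ : F →ₗ[R] G} {ψ : G →ₗ[R] N} (hφ : Function.Injective φ)
    (hφψ : Function.Exact φ ψ) (hψ : Function.Surjective ψ) {p : Ideal R} [p.IsPrime]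
    {n : ℕ} (hheight : p.height = (n : ℕ∞) + 1)
    (hR : ((n + 1 : ℕ) : ℕ∞) ≤ moduleDepth (Localization.AtPrime p) (Localization.AtPrime p))
    {a : F} (ha : φ a ∈ p • (⊤ : Submodule R G)) {θ : F →ₗ[R] R} (hθ : θ a ∉ p) :
    ¬ ((n + 1 : ℕ) : ℕ∞) ≤
      moduleDepth (Localization.AtPrime p) (LocalizedModule p.primeCompl N) := by
  have hR' : ¬ ((n + 2 : ℕ) : ℕ∞) ≤
      moduleDepth (Localization.AtPrime p) (Localization.AtPrime p) := by
    intro h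
    have h' := natCast_le_ringKrullDim_of_le_moduleDepth h
    rw [IsLocalization.AtPrime.ringKrullDim_eq_height p, hheight, WithBot.coe_le_coe] at h'
    norm_cast at h'
    omega
  have hmem : LocalizedModule.map p.primeCompl φ (LocalizedModule.mk a 1) ∈
      maximalIdeal (Localization.AtPrime p) •
        (⊤ : Submodule (Localization.AtPrime p) (LocalizedModule p.primeCompl G)) := by
    rw [LocalizedModule.map_mk]
    generalize φ a = b at ha
    induction ha using Submodule.smul_induction_on' with
    | smul r hr c _ =>
      have hrm : algebraMap R (Localization.AtPrime p) r ∈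
          maximalIdeal (Localization.AtPrime p) :=
        (IsLocalization.AtPrime.to_map_mem_maximal_iff (Localization.AtPrime p) p r).mpr hr
      have hrc : (LocalizedModule.mk (r • c) 1 : LocalizedModule p.primeCompl G) =
          algebraMap R (Localization.AtPrime p) r • LocalizedModule.mk c 1 := by
        rw [algebraMap_smul, LocalizedModule.smul'_mk]
      rw [hrc]
      exact Submodule.smul_mem_smul hrm Submodule.mem_top
    | add b _ c _ hb hc =>
      have : (LocalizedModule.mk (b + c) 1 : LocalizedModule p.primeCompl G) =
          LocalizedModule.mk b 1 + LocalizedModule.mk c 1 :=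
        map_add (LocalizedModule.mkLinearMap p.primeCompl G) b c
      rw [this]
      exact add_mem hb hc
  obtain ⟨u, hu⟩ := IsLocalization.map_units (Localization.AtPrime p) (⟨θ a, hθ⟩ : p.primeCompl)
  let θ' : LocalizedModule p.primeCompl F →ₗ[Localization.AtPrime p] Localization.AtPrime p :=
    IsLocalizedModule.mapExtendScalars p.primeCompl (LocalizedModule.mkLinearMap p.primeCompl F)
      (Algebra.linearMap R (Localization.AtPrime p)) (Localization.AtPrime p) θ
  have hθ' : θ' (LocalizedModule.mk a 1) = u := by
    rw [hu]
    exact IsLocalizedModule.map_apply p.primeCompl (LocalizedModule.mkLinearMap p.primeCompl F)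
      (Algebra.linearMap R (Localization.AtPrime p)) θ a
  exact not_le_moduleDepth_of_exact (g := LocalizedModule.map p.primeCompl ψ)
    (LocalizedModule.map_injective p.primeCompl φ hφ)
    (LocalizedModule.map_exact p.primeCompl φ ψ hφψ)
    (LocalizedModule.map_surjective p.primeCompl ψ hψ) hR hR' hmem
    (θ := (↑u⁻¹ : Localization.AtPrime p) • θ') (by
      rw [LinearMap.smul_apply, hθ', smul_eq_mul, Units.inv_mul])

lemma SatisfiesSerre.le_moduleDepth_localization {k : ℕ} (hR : SatisfiesSerre R R k)
    (q : Ideal R) [q.IsPrime] (hq : (k : ℕ∞) ≤ q.height) :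
    (k : ℕ∞) ≤ moduleDepth (Localization.AtPrime q) (Localization.AtPrime q) := by
  have hsupp : (⟨q, inferInstance⟩ : PrimeSpectrum R) ∈ Module.support R R :=
    Module.mem_support_iff.mpr ((localizedModuleSelfEquiv q).toEquiv.nontrivial)
  have h := hR _ hsupp
  rw [IsLocalization.AtPrime.ringKrullDim_eq_height q,
    min_eq_left (WithBot.coe_le_coe.mpr hq)] at h
  exact (WithBot.coe_le_coe.mp h).trans_eq (moduleGrade_congr _ (localizedModuleSelfEquiv q))

end Transpose

theorem theorem2p3 (R : Type u) [CommRing R] [IsNoetherianRing R]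
    (n : ℕ) (p : PrimeSpectrum R)
    (hgrade : 1 ≤ moduleGrade p.asIdeal R) (hheight : p.asIdeal.height = (n : ℕ∞) + 1)
    (X : Type u) [AddCommGroup X] [Module R X] [Module.Finite R X]
    (N : Type u) [AddCommGroup N] [Module R N] (hN : IsAuslanderTranspose R X N)
    (hR : SatisfiesSerre R R (n + 1))
    (hXtors : Module.IsTorsion R X)
    (hXp : ¬ Module.Free (Localization.AtPrime p.asIdeal)
      (LocalizedModule p.asIdeal.primeCompl X))
    (hXq : ∀ q : PrimeSpectrum R, ¬ p.asIdeal ≤ q.asIdeal →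
      Module.Free (Localization.AtPrime q.asIdeal) (LocalizedModule q.asIdeal.primeCompl X))
    (M : Type u) [AddCommGroup M] [Module R M] [Module.Finite R M] [Nontrivial M]
    (hM : SatisfiesSerre R M (n + 2)) (hpM : p ∉ Module.support R M) :
    SatisfiesSerre R (TensorProduct R M N) (n + 1) ∧
    ((∀ i : ℕ, 1 ≤ i → Limits.IsZero
        (((Tor (ModuleCat.{u} R) i).obj (ModuleCat.of R M)).obj (ModuleCat.of R N))) ∧
      projectiveDimension (ModuleCat.of R N) = 1) ∧
    (SatisfiesSerre R N n ∧ ¬ SatisfiesSerre R N (n + 1)) := by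
  obtain ⟨P₁, P₀, _, _, _, _, f, g, _, _, _, _, hfg, hg, ⟨e⟩⟩ := hN
  let φ := f.dualMap
  let ψ : Module.Dual R P₁ →ₗ[R] N := e.symm.toLinearMap ∘ₗ (LinearMap.range φ).mkQ
  have hφψ : Function.Exact φ ψ := fun y ↦ by
    simp [ψ, φ]
  have hψ : Function.Surjective ψ := e.symm.surjective.comp (Submodule.mkQ_surjective _)
  have := Module.Finite.of_surjective ψ hψ
  -- Every `t` annihilating `X` makes `φ` split up to the scalar `t`.
  have hsplit {t : R} (ht : t ∈ Module.annihilator R X) :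
      ∃ h : Module.Dual R P₁ →ₗ[R] Module.Dual R P₀, h ∘ₗ φ = t • LinearMap.id := by
    obtain ⟨h, hh⟩ := exists_comp_eq_smul_id hfg ht
    refine ⟨h.dualMap, LinearMap.ext fun b ↦ LinearMap.ext fun y ↦ ?_⟩
    have hy : f (h y) = t • y := LinearMap.congr_fun hh y
    simp [φ, hy]
  obtain ⟨s, hsX, hs⟩ := Submodule.annihilator_top_inter_nonZeroDivisors hXtors
  rw [SetLike.mem_coe, Submodule.annihilator_top] at hsX
  obtain ⟨h, hh⟩ := hsplit hsX
  have hφ : Function.Injective φ := by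
    have hreg : IsSMulRegular (Module.Dual R P₀) s :=
      Module.Flat.isSMulRegular_of_nonZeroDivisors (M := Module.Dual R P₀) hs
    refine Function.Injective.of_comp (f := h) fun x y hxy ↦ hreg ?_
    exact (LinearMap.congr_fun hh x).symm.trans (hxy.trans (LinearMap.congr_fun hh y))
  have hφM : Function.Injective (φ.lTensor M) :=
    lTensor_injective_of_comp_eq_smul_id hh (hM.isSMulRegular hs)
  have hφR : Function.Injective (φ.lTensor R) :=
    lTensor_injective_of_comp_eq_smul_id hh (hR.isSMulRegular hs)
  have hflat (q : PrimeSpectrum R) (hq : ¬ p.asIdeal ≤ q.asIdeal) :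
      Module.Flat (Localization.AtPrime q.asIdeal)
        (LocalizedModule q.asIdeal.primeCompl N) := by
    obtain ⟨t, ht, htq⟩ := SetLike.not_le_iff_exists.mp
      (annihilator_not_le_of_free_localizedModule hs hsX q (hXq q hq))
    obtain ⟨h', hh'⟩ := hsplit ht
    exact flat_localizedModule_of_comp_eq_smul_id hh' hφψ hψ q.asIdeal htq
  have hpX : p ∈ Module.support R X := by
    rw [Module.mem_support_iff]
    by_contra hnt
    rw [not_nontrivial_iff_subsingleton] at hnt
    exact hXp (Module.Free.of_subsingleton _ _)
  have hRp := hR.le_moduleDepth_localization p.asIdeal (by rw [hheight]; simp)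
  -- `φ a = a ∘ f` has values in `p`, while evaluation at `x` sends `a` outside `p`.
  obtain ⟨a, x, ha, hax⟩ := exists_dual_of_mem_support hfg hg hpX
  have hNp : ¬ ((n + 1 : ℕ) : ℕ∞) ≤ moduleDepth (Localization.AtPrime p.asIdeal)
      (LocalizedModule p.asIdeal.primeCompl N) :=
    not_le_moduleDepth_localized_of_exact hφ hφψ hψ hheight hRp (a := a)
      (mem_smul_top_dual ha) (θ := Module.Dual.eval R P₀ x) hax
  have hNflat : ¬ Module.Flat (Localization.AtPrime p.asIdeal)
      (LocalizedModule p.asIdeal.primeCompl N) := fun _ ↦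
    hNp (hRp.trans (moduleGrade_self_le_of_flat _))
  refine ⟨?_, ⟨fun i hi ↦ ?_, ?_⟩, ?_, fun hSerre ↦ hNp ?_⟩
  · refine SatisfiesSerre.tensorProduct hφM hφψ hψ hflat (fun q hq hpq ↦ ?_) hM
    -- `q` lies in the support of `M`, which misses `p`, so it contains `p` strictly.
    have hlt : p.asIdeal < q.asIdeal := by
      refine lt_of_le_of_ne hpq fun heq ↦ hpM ?_
      rwa [PrimeSpectrum.ext heq]
    have hle := Ideal.height_add_one_le_of_lt_of_isPrime hlt
    rw [hheight] at hle
    exact_mod_cast hle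
  · obtain ⟨i, rfl⟩ := Nat.exists_eq_add_of_le' hi
    exact isZero_Tor_of_lTensor_injective hφ hφψ hψ hφM i
  · refine projectiveDimension_eq_one hφ hφψ hψ fun hproj ↦ hNflat ?_
    infer_instance
  · refine (SatisfiesSerre.tensorProduct hφR hφψ hψ hflat (fun q _ hpq ↦ ?_) hR).congr
      (TensorProduct.lid R N)
    exact hheight.ge.trans (Ideal.height_mono hpq)
  · have hpN : p ∈ Module.support R N := by
      rw [Module.mem_support_iff]
      by_contra hnt
      rw [not_nontrivial_iff_subsingleton] at hnt
      exact hNflat inferInstance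
    have hle := hSerre p hpN
    rw [IsLocalization.AtPrime.ringKrullDim_eq_height p.asIdeal, hheight,
      min_eq_left (by rfl)] at hle
    exact WithBot.coe_le_coe.mp hle
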